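/- Let $A$ be a unital $C^*$-algebra. For $m\ge 1$ identify $A^m$ with the space of columns $M_{m,1}(A)$ with its usual norm, i.e. $\|a\|^2=\|a^*a\|$ where $a^*a=\sum_{i\le m}a_i^*a_i\in A$, and for $v\in A^m$, $y\in A$ write $vy=(v_1y,\dots,v_my)$. Let $\mathrm{Lg}_m(A)$ be the set of $a\in A^m$ with $A=Aa_1+\cdots+Aa_m$, and let the stable rank $\mathrm{sr}(A)\in\{1,2,\dots,\infty\}$ be the smallest $m\ge1$ such that $\mathrm{Lg}_m(A)$ is dense in $A^m$ (and $\infty$ if there is no such $m$). For $n\ge1$ let $\varphi_n$ be the sentence, in the language of unital $C^*$-algebras extended by quantification over the unit ball of $A^n$ and over the positive part of the unit ball of $A$, whose value in $A$ is $$\varphi_n^A=\sup_{x\in A^n,\ \|x\|\le1}\ \inf_{v\in A^n,\ \|v\|\le1}\ \inf_{y\in A_+,\ \|y\|\le1}\ \max\bigl(\|x-vy\|,\ \|v^*v-1\|\bigr).$$ Then, for every integer $n\ge 1$ and every unital $C^*$-algebra $A$, $\mathrm{sr}(A)\le n$ if and only if $\varphi_n^A=0$, and $\mathrm{sr}(A)>n$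 if and only if $\varphi_n^A\ge1$. -/

import Mathlib

/-- `A^n`, identified with the columns `M_{n,1}(A)`; its norm is the operator (C⋆-matrix) norm,
so that `‖a‖ ^ 2 = ‖∑ i, star (a i) * a i‖`. -/
abbrev Column (A : Type*) (n : ℕ) : Type _ := CStarMatrix (Fin n) (Fin 1) A

section

variable {A : Type*} [CStarAlgebra A] [PartialOrder A] [StarOrderedRing A] {n : ℕ}

/-- The right action `v y` of `A` on columns. -/
def Column.mulRight (v : Column A n) (y : A) : Column A n :=
  CStarMatrix.ofMatrix fun i j => v i j * y

/-- The element `v⋆ v = ∑ i, (v i)⋆ (v i)` of `A`. -/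
def Column.starMulSelf (v : Column A n) : A := ∑ i, star (v i 0) * v i 0

variable (A n)

/-- `Lg_n(A)`: the `n`-tuples `a` with `A = A a₁ + ⋯ + A aₙ`. -/
def Lg : Set (Column A n) := {a | ∀ b : A, ∃ c : Fin n → A, b = ∑ i, c i * a i 0}

/-- The (topological) stable rank: the smallest `m ≥ 1` for which `Lg_m(A)` is dense in `A^m`,
and `⊤` if there is none. -/
noncomputable def stableRank : ℕ∞ := ⨅ (m : ℕ) (_ : 1 ≤ m ∧ Dense (Lg A m)), (m : ℕ∞)

/-- The value `φ_n^A` of the sentence `φ_n` in `A`. All sets are nonempty, and all values lie in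
`[0, 2]`, so these are true suprema and infima. -/
noncomputable def phi : ℝ :=
  ⨆ x : {x : Column A n // ‖x‖ ≤ 1}, ⨅ v : {v : Column A n // ‖v‖ ≤ 1},
    ⨅ y : {y : A // 0 ≤ y ∧ ‖y‖ ≤ 1},
      max ‖x.1 - v.1.mulRight y.1‖ ‖v.1.starMulSelf - 1‖

end

/-! Density gives `phi` zero by polar decomposition: if `a` is in `Lg`, then `a⋆ a` is invertible
and `a = v y` with `v⋆ v = 1` and `y = (a⋆ a)^(1/2)`. Conversely, `phi < 1` puts every contractive
column `z` within distance `1` of some `b` in `Lg`. This already forces density. Up to a small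
error, any `x` is `z k²` with `z` a contraction and `z⋆ z k = k`. Compressing `(z - b)⋆ (z - b) ≤ 1`
by `k` cancels `k z⋆ z k` against `k²`, leaving `k (b⋆ z + z⋆ b) k ≥ k b⋆ b k ≥ 0`. So `k b⋆ z k +
δ` is invertible for every `δ > 0`, hence so is `b⋆ z k² + δ`, and `z k²` is a limit of elements of
`Lg`. Thus `phi` takes no value strictly between `0` and `1`, which gives both equivalences. -/

namespace Column

/-! ### Algebra of the `A`-valued inner product -/

section Algebra

variable {A : Type*} [CStarAlgebra A] {n : ℕ}

/-- The `A`-valued inner product `v⋆ w = ∑ i, (v i)⋆ (w i)` of two columns. -/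
def starMul (v w : Column A n) : A := ∑ i, star (v i 0) * w i 0

lemma starMul_self (v : Column A n) : starMul v v = v.starMulSelf := rfl

lemma mulRight_apply (v : Column A n) (y : A) (i : Fin n) (j : Fin 1) :
    v.mulRight y i j = v i j * y := rfl

lemma star_starMul (v w : Column A n) : star (starMul v w) = starMul w v := by
  simp [starMul]

lemma starMul_add (u v w : Column A n) : starMul u (v + w) = starMul u v + starMul u w := by
  simp [starMul, mul_add, Finset.sum_add_distrib]

lemma starMul_sub (u v w : Column A n) : starMul u (v - w) = starMul u v - starMul u w := by
  simp [starMul, mul_sub]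

lemma sub_starMul (u v w : Column A n) : starMul (u - v) w = starMul u w - starMul v w := by
  simp [starMul, sub_mul]

lemma starMul_mulRight (v w : Column A n) (y : A) :
    starMul v (w.mulRight y) = starMul v w * y := by
  simp [starMul, mulRight_apply, Finset.sum_mul, mul_assoc]

lemma mulRight_starMul (v w : Column A n) (y : A) :
    starMul (v.mulRight y) w = star y * starMul v w := by
  simp [starMul, mulRight_apply, Finset.mul_sum, mul_assoc]

lemma starMulSelf_mulRight (v : Column A n) (y : A) :
    (v.mulRight y).starMulSelf = star y * v.starMulSelf * y := by
  rw [← starMul_self, starMul_mulRight, mulRight_starMul, starMul_self]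

lemma starMulSelf_sub (v w : Column A n) : (v - w).starMulSelf =
    v.starMulSelf + w.starMulSelf - (starMul v w + starMul w v) := by
  simp only [← starMul_self, starMul_sub, sub_starMul]
  abel

lemma mulRight_mulRight (v : Column A n) (x y : A) :
    (v.mulRight x).mulRight y = v.mulRight (x * y) := by
  ext i j
  simp [mulRight_apply, mul_assoc]

lemma mulRight_sub (v : Column A n) (x y : A) :
    v.mulRight (x - y) = v.mulRight x - v.mulRight y := by
  ext i j
  simp [mulRight_apply, mul_sub]

lemma mulRight_add (v : Column A n) (x y : A) :
    v.mulRight (x + y) = v.mulRight x + v.mulRight y := by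
  ext i j
  simp [mulRight_apply, mul_add]

lemma mulRight_one (v : Column A n) : v.mulRight 1 = v := by
  ext i j
  simp [mulRight_apply]

lemma mem_Lg_of_isUnit_starMul {b a : Column A n} (h : IsUnit (starMul b a)) : a ∈ Lg A n := by
  obtain ⟨u, hu⟩ := h
  refine fun c => ⟨fun i => c * ↑u⁻¹ * star (b i 0), ?_⟩
  simp_rw [mul_assoc, ← Finset.mul_sum]
  change c = c * (↑u⁻¹ * starMul b a)
  rw [← hu, Units.inv_mul, mul_one]

end Algebra

/-! ### Norm of columns and invertibility of `a⋆ a` -/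

section Norm

variable {A : Type*} [CStarAlgebra A] [PartialOrder A] [StarOrderedRing A] {n : ℕ}

lemma starMulSelf_nonneg (v : Column A n) : 0 ≤ v.starMulSelf :=
  Finset.sum_nonneg fun _ _ => star_mul_self_nonneg _

lemma isSelfAdjoint_starMulSelf (v : Column A n) : IsSelfAdjoint v.starMulSelf :=
  .of_nonneg v.starMulSelf_nonneg

open WithCStarModule in
/-- The norm of a column satisfies the `C⋆`-identity. -/
lemma norm_sq_eq (v : Column A n) : ‖v‖ ^ 2 = ‖v.starMulSelf‖ := by
  -- As an operator, `v` is the inner product with the adjoint tuple `x`; Cauchy–Schwarz and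
  -- evaluation at `x` give `‖v‖ = ‖x‖`.
  let x : C⋆ᵐᵒᵈ(A, Fin n → A) := (equiv _ _).symm fun i => star (v i 0)
  have hx : ‖x‖ ^ 2 = ‖v.starMulSelf‖ := by
    rw [pi_norm_sq]
    simp [x, inner_def, starMulSelf]
  have hone (w : C⋆ᵐᵒᵈ(A, Fin 1 → A)) : ‖w‖ = ‖w 0‖ := by
    rw [← sq_eq_sq₀ (norm_nonneg _) (norm_nonneg _), pi_norm_sq]
    simp [inner_def, CStarRing.norm_self_mul_star, sq]
  have happ (u : C⋆ᵐᵒᵈ(A, Fin n → A)) :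
      CStarMatrix.toCLM v u 0 = inner A x u := by
    rw [CStarMatrix.toCLM_apply_eq_sum, pi_inner]
    simp [x, inner_def]
  have h1 : ‖v‖ ≤ ‖x‖ := by
    rw [CStarMatrix.norm_def]
    refine ContinuousLinearMap.opNorm_le_bound _ (norm_nonneg _) fun u => ?_
    rw [hone, happ]
    exact CStarModule.norm_inner_le _
  have h2 : ‖x‖ ≤ ‖v‖ := by
    have h := (CStarMatrix.toCLM v).le_opNorm x
    rw [hone, happ, ← CStarModule.norm_sq_eq A, ← CStarMatrix.norm_def] at h
    nlinarith [norm_nonneg x, norm_nonneg v]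
  rw [← hx, le_antisymm h1 h2]

lemma norm_mulRight_le (v : Column A n) (y : A) : ‖v.mulRight y‖ ≤ ‖v‖ * ‖y‖ := by
  refine le_of_sq_le_sq ?_ (by positivity)
  rw [norm_sq_eq, starMulSelf_mulRight, mul_pow, norm_sq_eq]
  calc _ ≤ ‖star y‖ * ‖v.starMulSelf‖ * ‖y‖ :=
        (norm_mul_le _ _).trans (by gcongr; exact norm_mul_le _ _)
    _ = _ := by rw [norm_star]; ring

lemma norm_le_of_starMulSelf_le_one {v : Column A n} (h : v.starMulSelf ≤ 1) : ‖v‖ ≤ 1 := by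
  have := (CStarAlgebra.norm_le_one_iff_of_nonneg _ v.starMulSelf_nonneg).2 h
  rw [← norm_sq_eq] at this
  exact (sq_le_one_iff₀ (norm_nonneg _)).1 this

lemma starMulSelf_le_one {v : Column A n} (h : ‖v‖ ≤ 1) : v.starMulSelf ≤ 1 := by
  rw [← CStarAlgebra.norm_le_one_iff_of_nonneg _ v.starMulSelf_nonneg, ← norm_sq_eq]
  exact pow_le_one₀ (norm_nonneg _) h

/-- With `d⋆ a = 1`, expanding `0 ≤ (a - d t)⋆ (a - d t)` gives `a⋆ a ≥ 2t - t² d⋆ d`, which is at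
least `t` once `t ‖d⋆ d‖ ≤ 1`. -/
lemma isUnit_starMulSelf {a : Column A n} (ha : a ∈ Lg A n) : IsUnit a.starMulSelf := by
  obtain ⟨c, hc⟩ := ha 1
  let d : Column A n := CStarMatrix.ofMatrix fun i _ => star (c i)
  have hda : starMul d a = 1 := by
    rw [hc]
    exact Finset.sum_congr rfl fun i _ => congrArg (· * a i 0) (star_star (c i))
  have had : starMul a d = 1 := by rw [← star_starMul, hda, star_one]
  set t : ℝ := (1 + ‖d.starMulSelf‖)⁻¹ with ht
  have ht0 : 0 < t := by positivity
  have hpos := (a - d.mulRight (algebraMap ℝ A t)).starMulSelf_nonneg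
  have hst : star (algebraMap ℝ A t) = algebraMap ℝ A t :=
    (IsSelfAdjoint.algebraMap A (IsSelfAdjoint.all t)).star_eq
  rw [starMulSelf_sub, starMulSelf_mulRight, starMul_mulRight, mulRight_starMul, hda, had, hst,
    one_mul, mul_one, ← Algebra.commutes, ← mul_assoc, ← map_mul] at hpos
  have hd : algebraMap ℝ A (t * t) * d.starMulSelf ≤ algebraMap ℝ A t := by
    have h1 : d.starMulSelf ≤ algebraMap ℝ A ‖d.starMulSelf‖ :=
      d.isSelfAdjoint_starMulSelf.le_algebraMap_norm_self
    rw [← Algebra.smul_def]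
    refine (smul_le_smul_of_nonneg_left h1 (by positivity)).trans ?_
    rw [Algebra.smul_def, ← map_mul]
    refine algebraMap_mono A ?_
    have : t * (1 + ‖d.starMulSelf‖) = 1 := inv_mul_cancel₀ (by positivity)
    nlinarith [norm_nonneg d.starMulSelf]
  have hle : algebraMap ℝ A t ≤ a.starMulSelf := by
    have h2 : algebraMap ℝ A t + algebraMap ℝ A t ≤
        a.starMulSelf + algebraMap ℝ A (t * t) * d.starMulSelf := by
      simpa using hpos
    have h3 := h2.trans (by gcongr : _ ≤ a.starMulSelf + algebraMap ℝ A t)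
    exact le_of_add_le_add_right h3
  refine CStarAlgebra.isUnit_of_le _ hle ?_
  exact ⟨by simpa using algebraMap_mono A ht0.le, (isUnit_iff_ne_zero.2 ht0.ne').map (algebraMap ℝ A)⟩

lemma mulRight_mem_Lg {v : Column A n} {y : A} (hv : v ∈ Lg A n) (hy : IsUnit y) :
    v.mulRight y ∈ Lg A n := by
  refine mem_Lg_of_isUnit_starMul (b := v) ?_
  rw [starMul_mulRight]
  exact (isUnit_starMulSelf hv).mul hy

end Norm

end Column

/-- `a * b` and `b * a` have the same nonzero spectrum. -/
lemma isUnit_mul_add_algebraMap_comm {A : Type*} [Ring A] [Algebra ℝ A] {a b : A} {ε : ℝ} (hε : ε ≠ 0)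
    (h : IsUnit (a * b + algebraMap ℝ A ε)) : IsUnit (b * a + algebraMap ℝ A ε) := by
  have key (x : A) : IsUnit (x + algebraMap ℝ A ε) ↔ -ε ∉ spectrum ℝ x := by
    rw [spectrum.notMem_iff, ← IsUnit.neg_iff]
    rw [neg_add', map_neg, sub_eq_add_neg, sub_eq_add_neg, add_comm]
  rw [key] at h ⊢
  have := spectrum.unit_mem_mul_comm (a := a) (b := b) (r := Units.mk0 (-ε) (neg_ne_zero.2 hε))
  exact fun hb => h (this.2 hb)

section RealPart

variable {A : Type*} [CStarAlgebra A] [PartialOrder A] [StarOrderedRing A]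

/-- An element whose real part is bounded below by a positive scalar is invertible. -/
lemma isUnit_of_algebraMap_le_add_star {a : A} {ε : ℝ} (hε : 0 < ε)
    (h : algebraMap ℝ A ε + algebraMap ℝ A ε ≤ a + star a) : IsUnit a := by
  have hunit (b : A) (hb : algebraMap ℝ A ε + algebraMap ℝ A ε ≤ b + star b) :
      IsUnit (star b * b) := by
    have hst : star (algebraMap ℝ A ε) = algebraMap ℝ A ε :=
      (IsSelfAdjoint.algebraMap A (IsSelfAdjoint.all ε)).star_eq
    have h1 := star_mul_self_nonneg (b - algebraMap ℝ A ε)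
    have h2 : algebraMap ℝ A ε * (algebraMap ℝ A ε + algebraMap ℝ A ε) ≤
        algebraMap ℝ A ε * (b + star b) := by
      rw [← Algebra.smul_def, ← Algebra.smul_def]
      exact smul_le_smul_of_nonneg_left hb hε.le
    -- From `(b - ε)⋆ (b - ε) ≥ 0`: `b⋆ b ≥ ε (b + b⋆) - ε² ≥ ε²`.
    have h3 : algebraMap ℝ A (ε * ε) ≤ star b * b := by
      rw [map_mul, ← sub_nonneg]
      have := add_nonneg h1 (sub_nonneg.2 h2)
      rw [star_sub, hst] at this
      convert this using 1
      have := Algebra.commutes ε (star b)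
      simp only [mul_add, sub_mul, mul_sub, this]
      abel
    refine CStarAlgebra.isUnit_of_le _ h3 ⟨?_, ?_⟩
    · simpa using algebraMap_mono A (mul_pos hε hε).le
    · exact (isUnit_iff_ne_zero.2 (mul_pos hε hε).ne').map (algebraMap ℝ A)
  obtain ⟨u, hu⟩ := hunit a h
  obtain ⟨w, hw⟩ := hunit (star a) (by rwa [star_star, add_comm (star a)])
  rw [star_star] at hw
  have hl : (↑u⁻¹ * star a) * a = 1 := by rw [mul_assoc, ← hu, Units.inv_mul]
  have hr : a * (star a * ↑w⁻¹) = 1 := by rw [← mul_assoc, ← hw, Units.mul_inv]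
  exact ⟨⟨a, _, hr, left_inv_eq_right_inv hl hr ▸ hl⟩, rfl⟩

end RealPart

/-! ### Distance at most one implies density -/

section Density

variable {A : Type*} [CStarAlgebra A] [PartialOrder A] [StarOrderedRing A] {n : ℕ}

open Column

/-- If `b ∈ Lg_n(A)` is within distance `1` of `z`, then `b⋆ z` has nonnegative real part where
`z` is isometric. -/
lemma Column.conjugate_starMul_add_nonneg {z b : Column A n} {k : A} (hk : IsSelfAdjoint k)
    (hz : z.starMulSelf * k = k) (hzb : ‖z - b‖ ≤ 1) :
    0 ≤ k * (starMul b z) * k + star (k * (starMul b z) * k) := by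
  have h1 := hk.conjugate_le_conjugate (starMulSelf_le_one hzb)
  have h2 := hk.conjugate_nonneg b.starMulSelf_nonneg
  rw [starMulSelf_sub] at h1
  have h3 := add_nonneg (sub_nonneg.2 h1) h2
  convert h3 using 1
  simp only [star_mul, star_starMul, hk.star_eq, mul_sub, sub_mul, mul_add, add_mul, mul_one]
  rw [mul_assoc k z.starMulSelf, hz]
  simp only [mul_assoc]
  abel

lemma Column.mulRight_mul_self_mem_closure_Lg {z b : Column A n} {k : A} (hk : IsSelfAdjoint k)
    (hz : z.starMulSelf * k = k) (hb : b ∈ Lg A n) (hzb : ‖z - b‖ ≤ 1) :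
    z.mulRight (k * k) ∈ closure (Lg A n) := by
  obtain ⟨u, hu⟩ := isUnit_starMulSelf hb
  rw [Metric.mem_closure_iff]
  intro ε hε
  set C := ‖b.mulRight ↑u⁻¹‖ with hC
  -- The factor `1 + ‖1‖` covers the zero algebra, where `‖1‖ = 0`.
  set δ : ℝ := ε / (2 * (C + 1)) / (1 + ‖(1 : A)‖) with hδ
  have hC0 : 0 ≤ C := norm_nonneg _
  have hδ0 : 0 < δ := by positivity
  -- Pairing `b` with the correction `b (b⋆ b)⁻¹ δ` yields exactly `δ`.
  refine ⟨z.mulRight (k * k) + (b.mulRight ↑u⁻¹).mulRight (algebraMap ℝ A δ), ?_, ?_⟩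
  · refine mem_Lg_of_isUnit_starMul (b := b) ?_
    rw [starMul_add, starMul_mulRight, starMul_mulRight, starMul_mulRight, starMul_self, ← hu,
      Units.mul_inv, one_mul, ← mul_assoc]
    refine isUnit_mul_add_algebraMap_comm hδ0.ne' ?_
    refine isUnit_of_algebraMap_le_add_star hδ0 ?_
    have h := conjugate_starMul_add_nonneg hk hz hzb
    have hst : star (algebraMap ℝ A δ) = algebraMap ℝ A δ :=
      (IsSelfAdjoint.algebraMap A (IsSelfAdjoint.all δ)).star_eq
    rw [star_add, hst, ← sub_nonneg, ← mul_assoc]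
    convert h using 1
    abel
  · rw [dist_eq_norm, sub_add_cancel_left, norm_neg]
    refine (norm_mulRight_le _ _).trans_lt ?_
    rw [norm_algebraMap, Real.norm_of_nonneg hδ0.le, ← hC, hδ, div_mul_eq_mul_div,
      mul_div_assoc', div_lt_iff₀ (by positivity), mul_comm, div_mul_eq_mul_div,
      div_mul_eq_mul_div, div_lt_iff₀ (by positivity)]
    have h1 : 0 ≤ ‖(1 : A)‖ := norm_nonneg _
    nlinarith [mul_nonneg hC0 h1, mul_pos hε hε, mul_nonneg hε.le hC0, mul_nonneg hε.le h1,
      mul_nonneg hε.le (mul_nonneg hC0 h1)]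

/-- The truncated polar decomposition: `x` is within `r` of `z k²`, where `z` is a contraction
whose modulus acts as a unit on `k`. -/
lemma Column.exists_truncation (x : Column A n) {r : ℝ} (hr : 0 < r) :
    ∃ (z : Column A n) (k : A), IsSelfAdjoint k ∧ ‖z‖ ≤ 1 ∧ z.starMulSelf * k = k ∧
      ‖x - z.mulRight (k * k)‖ ≤ r := by
  set s := x.starMulSelf with hs
  have hs0 : 0 ≤ s := x.starMulSelf_nonneg
  have hsa : IsSelfAdjoint s := .of_nonneg hs0
  -- Take `z = x m(s)⁻¹` and `k² = m(s) - r`. Where `√t ≤ r`, `k` vanishes; elsewhere `m t = √t`, so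
  -- `z⋆ z` acts as `1`. The error is `r x m(s)⁻¹`, of norm at most `r`.
  set m : ℝ → ℝ := fun t => max (√t) r with hm
  have hm0 (t : ℝ) : 0 < m t := lt_max_of_lt_right hr
  have hmc : Continuous m := by fun_prop
  have hgc : Continuous fun t => (m t)⁻¹ := hmc.inv₀ fun t => (hm0 t).ne'
  have hspec {t : ℝ} (ht : t ∈ spectrum ℝ s) : 0 ≤ t := spectrum_nonneg_of_nonneg hs0 ht
  have hsq {t : ℝ} (ht : t ∈ spectrum ℝ s) : t = √t * √t := (Real.mul_self_sqrt (hspec ht)).symm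
  -- conjugating `s` by a function of `s`
  have hconj (f : ℝ → ℝ) (hf : Continuous f) :
      (x.mulRight (cfc f s)).starMulSelf = cfc (fun t => f t * t * f t) s := by
    rw [starMulSelf_mulRight, ← hs, (cfc_predicate f s).star_eq,
      cfc_mul (fun t => f t * t) f s, cfc_mul f (fun t => t) s, cfc_id' ℝ s]
  have hz : (x.mulRight (cfc (fun t => (m t)⁻¹) s)).starMulSelf =
      cfc (fun t => (m t)⁻¹ * t * (m t)⁻¹) s := hconj _ hgc
  have hkc : Continuous fun t => √(m t - r) := by fun_prop
  refine ⟨x.mulRight (cfc (fun t => (m t)⁻¹) s), cfc (fun t => √(m t - r)) s,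
    cfc_predicate _ s, ?_, ?_, ?_⟩
  · refine norm_le_of_starMulSelf_le_one ?_
    rw [hz]
    refine cfc_le_one _ _ fun t ht => ?_
    have h1 : √t ≤ m t := le_max_left _ _
    have h2 := hm0 t
    have : (m t)⁻¹ * t * (m t)⁻¹ = (√t / m t) * (√t / m t) := by
      nth_rw 2 [hsq ht]
      ring
    rw [this]
    have h3 : √t / m t ≤ 1 := (div_le_one h2).2 h1
    exact mul_le_one₀ h3 (by positivity) h3
  · rw [hz, ← cfc_mul _ _ s (by fun_prop) (by fun_prop)]
    refine cfc_congr fun t ht => ?_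
    rcases le_total r (√t) with h | h
    · have : m t = √t := max_eq_left h
      have h0 : √t ≠ 0 := (hr.trans_le h).ne'
      simp only [this]
      nth_rw 2 [hsq ht]
      field_simp
    · have : m t = r := max_eq_right h
      simp [this]
  · have hkk : Continuous fun t => √(m t - r) * √(m t - r) := hkc.mul hkc
    have hgkk : Continuous fun t => (m t)⁻¹ * (√(m t - r) * √(m t - r)) := hgc.mul hkk
    have hdiff : x - (x.mulRight (cfc (fun t => (m t)⁻¹) s)).mulRight
        (cfc (fun t => √(m t - r)) s * cfc (fun t => √(m t - r)) s) =
        x.mulRight (cfc (fun t => r * (m t)⁻¹) s) := by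
      nth_rw 1 [← mulRight_one x]
      rw [mulRight_mulRight, ← mulRight_sub, ← cfc_one ℝ s,
        ← cfc_mul _ _ s hkc.continuousOn hkc.continuousOn,
        ← cfc_mul _ _ s hgc.continuousOn hkk.continuousOn,
        ← cfc_sub _ _ s continuous_one.continuousOn hgkk.continuousOn]
      congr 1
      refine cfc_congr fun t _ => ?_
      have h1 : 0 ≤ m t - r := sub_nonneg.2 (le_max_right _ _)
      have h2 := (hm0 t).ne'
      simp only [Pi.one_apply, Real.mul_self_sqrt h1]
      field_simp
      ring
    rw [hdiff]
    refine le_of_sq_le_sq ?_ hr.le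
    rw [norm_sq_eq, hconj _ (by fun_prop)]
    refine norm_cfc_le (by positivity) fun t ht => ?_
    have h1 : √t ≤ m t := le_max_left _ _
    have h2 := hm0 t
    have h3 : √t / m t ≤ 1 := (div_le_one h2).2 h1
    have h4 : r * (m t)⁻¹ * t * (r * (m t)⁻¹) = r ^ 2 * ((√t / m t) * (√t / m t)) := by
      nth_rw 2 [hsq ht]
      ring
    rw [h4, Real.norm_of_nonneg (by positivity)]
    exact mul_le_of_le_one_right (by positivity) (mul_le_one₀ h3 (by positivity) h3)

/-- If every contractive column is at distance at most `1` from some element of `Lg_n(A)`,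
then `Lg_n(A)` is dense. -/
lemma dense_Lg_of_forall_exists_norm_sub_le_one
    (h : ∀ z : Column A n, ‖z‖ ≤ 1 → ∃ b ∈ Lg A n, ‖z - b‖ ≤ 1) : Dense (Lg A n) := by
  intro x
  rw [← closure_closure, Metric.mem_closure_iff]
  intro ε hε
  obtain ⟨z, k, hk, hz1, hzk, hxz⟩ := x.exists_truncation (half_pos hε)
  obtain ⟨b, hb, hzb⟩ := h z hz1
  refine ⟨_, mulRight_mul_self_mem_closure_Lg hk hzk hb hzb, ?_⟩
  rw [dist_eq_norm]
  linarith

end Density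

/-! ### Monotonicity of density in the number of generators -/

section StableRank

variable {A : Type*} [CStarAlgebra A] [PartialOrder A] [StarOrderedRing A]

open Column

/-- Perturb the first `m` entries into `Lg` and keep the last, which gets coefficient `0`. -/
lemma dense_Lg_succ {m : ℕ} (h : Dense (Lg A m)) : Dense (Lg A (m + 1)) := by
  intro a
  rw [Metric.mem_closure_iff]
  intro ε hε
  let a' : Column A m := CStarMatrix.ofMatrix fun i _ => a i.castSucc 0
  obtain ⟨b, hb, hab⟩ := Metric.mem_closure_iff.1 (h a') ε hε
  let c : Column A (m + 1) :=
    CStarMatrix.ofMatrix fun i _ => Fin.snoc (α := fun _ => A) (fun i => b i 0) (a (Fin.last m) 0) i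
  have hc (i : Fin m) : c i.castSucc 0 = b i 0 :=
    Fin.snoc_castSucc (α := fun _ => A) (a (Fin.last m) 0) (fun i => b i 0) i
  have hcl : c (Fin.last m) 0 = a (Fin.last m) 0 :=
    Fin.snoc_last (α := fun _ => A) (a (Fin.last m) 0) (fun i => b i 0)
  refine ⟨c, fun x => ?_, ?_⟩
  · obtain ⟨d, hd⟩ := hb x
    refine ⟨Fin.snoc (α := fun _ => A) d 0, ?_⟩
    rw [Fin.sum_univ_castSucc]
    simp [hc, hd]
  · rw [dist_eq_norm] at hab ⊢
    convert hab using 1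
    rw [← sq_eq_sq₀ (norm_nonneg _) (norm_nonneg _), norm_sq_eq, norm_sq_eq]
    congr 1
    simp only [starMulSelf]
    rw [Fin.sum_univ_castSucc]
    simp only [CStarMatrix.sub_apply, hc, hcl, sub_self, star_zero, mul_zero, add_zero]
    rfl

lemma stableRank_le_iff_dense_Lg {n : ℕ} (hn : 1 ≤ n) :
    stableRank A ≤ n ↔ Dense (Lg A n) := by
  refine ⟨fun h => ?_, fun h => iInf₂_le n ⟨hn, h⟩⟩
  have h' : stableRank A < ((n + 1 : ℕ) : ℕ∞) := h.trans_lt (by exact_mod_cast n.lt_succ_self)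
  obtain ⟨m, hm⟩ := iInf_lt_iff.1 h'
  obtain ⟨⟨_, hd⟩, hmn⟩ := iInf_lt_iff.1 hm
  have hle : m ≤ n := Nat.lt_succ_iff.1 (by exact_mod_cast hmn)
  clear h h' hm hn hmn
  induction n, hle using Nat.le_induction with
  | base => exact hd
  | succ k _ ih => exact dense_Lg_succ ih

end StableRank

/-! ### The values of `phi` -/

section Phi

variable {A : Type*} [CStarAlgebra A] [PartialOrder A] [StarOrderedRing A] {n : ℕ}

open Column

/-- The polar decomposition of an element of `Lg_n(A)`. -/
lemma Column.exists_polar {a : Column A n} (ha : a ∈ Lg A n) :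
    ∃ (v : Column A n) (y : A), v.starMulSelf = 1 ∧ 0 ≤ y ∧ ‖y‖ ≤ ‖a‖ ∧ v.mulRight y = a := by
  have hpos : IsStrictlyPositive a.starMulSelf := ⟨a.starMulSelf_nonneg, isUnit_starMulSelf ha⟩
  obtain ⟨u, hu⟩ := hpos.isUnit_cfcSqrt
  have hu0 : 0 ≤ (u : A) := hu ▸ CFC.sqrt_nonneg _
  have huu : (u : A) * u = a.starMulSelf := hu ▸ CFC.sqrt_mul_sqrt_self _
  have hus : star (u : A) = u := (IsSelfAdjoint.of_nonneg hu0).star_eq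
  have hus' : star (↑u⁻¹ : A) = ↑u⁻¹ := by
    rw [← Units.coe_star_inv]
    congr 2
    exact Units.ext hus
  refine ⟨a.mulRight ↑u⁻¹, u, ?_, hu0, ?_, ?_⟩
  · rw [starMulSelf_mulRight, ← huu, hus', ← mul_assoc, Units.inv_mul, one_mul, Units.mul_inv]
  · refine le_of_sq_le_sq ?_ (norm_nonneg _)
    rw [norm_sq_eq, ← huu, sq]
    nth_rw 3 [← hus]
    exact (CStarRing.norm_star_mul_self (x := (u : A))).ge
  · rw [mulRight_mulRight, Units.inv_mul, mulRight_one]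

lemma bddBelow_max_norm (x v : Column A n) :
    BddBelow (Set.range fun y : {y : A // 0 ≤ y ∧ ‖y‖ ≤ 1} =>
      max ‖x - v.mulRight y.1‖ ‖v.starMulSelf - 1‖) :=
  ⟨0, by rintro _ ⟨y, rfl⟩; exact le_max_of_le_left (norm_nonneg _)⟩

lemma bddBelow_iInf_max_norm (x : Column A n) :
    BddBelow (Set.range fun v : {v : Column A n // ‖v‖ ≤ 1} =>
      ⨅ y : {y : A // 0 ≤ y ∧ ‖y‖ ≤ 1},
        max ‖x - v.1.mulRight y.1‖ ‖v.1.starMulSelf - 1‖) :=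
  ⟨0, by
    rintro _ ⟨v, rfl⟩
    exact Real.iInf_nonneg fun y => le_max_of_le_left (norm_nonneg _)⟩

lemma iInf_iInf_max_norm_le (x v : Column A n) (y : A) (hv : ‖v‖ ≤ 1) (hy0 : 0 ≤ y)
    (hy1 : ‖y‖ ≤ 1) :
    ⨅ v : {v : Column A n // ‖v‖ ≤ 1}, ⨅ y : {y : A // 0 ≤ y ∧ ‖y‖ ≤ 1},
      max ‖x - v.1.mulRight y.1‖ ‖v.1.starMulSelf - 1‖ ≤
      max ‖x - v.mulRight y‖ ‖v.starMulSelf - 1‖ :=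
  (ciInf_le (bddBelow_iInf_max_norm x) ⟨v, hv⟩).trans
    (ciInf_le (bddBelow_max_norm x v) ⟨y, hy0, hy1⟩)

lemma phi_nonneg : 0 ≤ phi A n :=
  Real.iSup_nonneg fun _ => Real.iInf_nonneg fun _ => Real.iInf_nonneg fun _ =>
    le_max_of_le_left (norm_nonneg _)

lemma phi_le_zero_of_dense_Lg (h : Dense (Lg A n)) : phi A n ≤ 0 := by
  refine Real.iSup_le (fun ⟨x, hx⟩ => ?_) le_rfl
  refine le_of_forall_pos_le_add fun ε hε => ?_
  rw [zero_add]
  obtain ⟨a, ha, hxa⟩ := Metric.mem_closure_iff.1 (h x) (ε / 2) (half_pos hε)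
  rw [dist_eq_norm] at hxa
  obtain ⟨v, y, hv, hy0, hya, hvy⟩ := exists_polar ha
  have hna : ‖a‖ ≤ 1 + ε / 2 := by
    have := norm_le_norm_add_norm_sub x a
    linarith
  -- rescale so that `y` becomes a contraction
  set c : ℝ := (1 + ε / 2)⁻¹ with hc
  have hc0 : 0 < c := by positivity
  have hcc : c * (1 + ε / 2) = 1 := inv_mul_cancel₀ (by positivity)
  have hv1 : ‖v‖ ≤ 1 := norm_le_of_starMulSelf_le_one hv.le
  refine (iInf_iInf_max_norm_le x v (c • y) hv1 (smul_nonneg hc0.le hy0) ?_).trans ?_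
  · rw [norm_smul, Real.norm_of_nonneg hc0.le]
    exact (mul_le_mul_of_nonneg_left (hya.trans hna) hc0.le).trans hcc.le
  · rw [hv, sub_self, norm_zero, max_eq_left (norm_nonneg _)]
    have h1 : x - v.mulRight (c • y) = (x - a) + v.mulRight ((1 - c) • y) := by
      rw [sub_smul, one_smul, mulRight_sub, hvy]
      abel
    have h2 : c ≤ 1 := inv_le_one_of_one_le₀ (by linarith)
    have h3 : ‖v.mulRight ((1 - c) • y)‖ ≤ (1 - c) * (1 + ε / 2) := by
      refine (norm_mulRight_le _ _).trans ?_
      rw [norm_smul, Real.norm_of_nonneg (sub_nonneg.2 h2)]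
      refine (mul_le_of_le_one_left (by have := sub_nonneg.2 h2; positivity) hv1).trans ?_
      exact mul_le_mul_of_nonneg_left (hya.trans hna) (sub_nonneg.2 h2)
    rw [h1]
    refine (norm_add_le _ _).trans ?_
    nlinarith

lemma dense_Lg_of_phi_lt_one (h : phi A n < 1) : Dense (Lg A n) := by
  refine dense_Lg_of_forall_exists_norm_sub_le_one fun z hz => ?_
  -- Testing `v = 0`, `y = 0` bounds the supremum, as `le_ciSup` requires.
  have hbdd : BddAbove (Set.range fun x : {x : Column A n // ‖x‖ ≤ 1} =>
      ⨅ v : {v : Column A n // ‖v‖ ≤ 1}, ⨅ y : {y : A // 0 ≤ y ∧ ‖y‖ ≤ 1},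
        max ‖x.1 - v.1.mulRight y.1‖ ‖v.1.starMulSelf - 1‖) := by
    refine ⟨max 1 ‖(1 : A)‖, ?_⟩
    rintro _ ⟨x, rfl⟩
    refine (iInf_iInf_max_norm_le x.1 0 0 (by simp) le_rfl (by simp)).trans ?_
    have h1 : Column.mulRight (0 : Column A n) 0 = 0 := by
      ext i j
      simp [mulRight_apply]
    have h2 : (0 : Column A n).starMulSelf = 0 := by simp [starMulSelf]
    rw [h1, h2, sub_zero, zero_sub, norm_neg]
    exact max_le_max_right _ x.2
  have hlt := (le_ciSup hbdd ⟨z, hz⟩).trans_lt h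
  have : Nonempty {v : Column A n // ‖v‖ ≤ 1} := ⟨⟨0, by simp⟩⟩
  have : Nonempty {y : A // 0 ≤ y ∧ ‖y‖ ≤ 1} := ⟨⟨0, le_rfl, by simp⟩⟩
  obtain ⟨⟨v, _⟩, hv⟩ := exists_lt_of_ciInf_lt hlt
  obtain ⟨⟨y, hy0, hy1⟩, hy⟩ := exists_lt_of_ciInf_lt hv
  obtain ⟨hzv, hv1⟩ := max_lt_iff.1 hy
  have hunit : IsUnit v.starMulSelf := by
    have := isUnit_one_sub_of_norm_lt_one ((norm_sub_rev _ _).trans_lt hv1)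
    rwa [sub_sub_cancel] at this
  have hvL : v ∈ Lg A n := mem_Lg_of_isUnit_starMul hunit
  -- perturb `y` to an invertible element
  set δ : ℝ := (1 - ‖z - v.mulRight y‖) / (‖v‖ * ‖(1 : A)‖ + 1) with hδ
  have hδ0 : 0 < δ := div_pos (sub_pos.2 hzv) (by positivity)
  have hsp : IsStrictlyPositive (algebraMap ℝ A δ) :=
    ⟨by simpa using algebraMap_mono A hδ0.le,
      (isUnit_iff_ne_zero.2 hδ0.ne').map (algebraMap ℝ A)⟩
  refine ⟨v.mulRight (y + algebraMap ℝ A δ),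
    mulRight_mem_Lg hvL (hsp.nonneg_add hy0).isUnit, ?_⟩
  rw [mulRight_add, ← sub_sub]
  refine (norm_sub_le _ _).trans ?_
  have h1 : ‖v.mulRight (algebraMap ℝ A δ)‖ ≤ 1 - ‖z - v.mulRight y‖ := by
    refine (norm_mulRight_le _ _).trans ?_
    rw [norm_algebraMap, Real.norm_of_nonneg hδ0.le]
    have h2 : δ * (‖v‖ * ‖(1 : A)‖ + 1) = 1 - ‖z - v.mulRight y‖ :=
      div_mul_cancel₀ _ (by positivity)
    linarith
  linarith

end Phi

theorem mainTheorem4 {A : Type*} [CStarAlgebra A] [PartialOrder A] [StarOrderedRing A]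
    (n : ℕ) (hn : 1 ≤ n) :
    (stableRank A ≤ n ↔ phi A n = 0) ∧ ((n : ℕ∞) < stableRank A ↔ 1 ≤ phi A n) := by
  rw [← not_le (a := stableRank A), ← not_lt (a := phi A n), stableRank_le_iff_dense_Lg hn]
  have h0 (h : Dense (Lg A n)) : phi A n = 0 := (phi_le_zero_of_dense_Lg h).antisymm phi_nonneg
  have h1 : phi A n < 1 → Dense (Lg A n) := dense_Lg_of_phi_lt_one
  exact ⟨⟨h0, fun h => h1 (h ▸ one_pos)⟩,
    not_congr ⟨fun h => (h0 h).trans_lt one_pos, h1⟩⟩
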